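/- Let $K$ be a field, let $n\ge 1$, and let $G$ be a simple graph on the vertex set $[n]=\{1,\dots,n\}$. Let $S=K[x_1,\dots,x_n,y_1,\dots,y_n]$ with the standard grading ($\deg x_i=\deg y_i=1$), and let $J_G\subseteq S$ be the binomial edge ideal of $G$, that is, the ideal generated by all binomials $x_iy_j-x_jy_i$ with $i<j$ and $\{i,j\}$ an edge of $G$. For a homogeneous ideal $I\subseteq S$ let $H(S/I,t)=\sum_{d\ge 0}\dim_K (S/I)_d\,t^d$ denote the Hilbert series of $S/I$. Let $\mathcal T_3$ be the class of graphs whose vertices can be listed without repetition as $u_1,\dots,u_r,v_1,\dots,v_s,w_1,\dots,w_t$, with $r\ge 2$, $s\ge 1$, $t\ge 1$, such that the edges are exactly $\{u_i,u_{i+1}\}$ ($1\le i\le r-1$), $\{v_i,v_{i+1}\}$ ($1\le i\le s-1$), $\{w_i,w_{i+1}\}$ ($1\le i\le t-1$), $\{u_1,v_1\}$ and $\{u_1,w_1\}$. Let $\mathcal G_3$ be the class of graphs whose vertices can be listed without repetition in the same form, with $r\ge 1$, $s\ge 1$, $t\ge 1$, such that the edges are exactly $\{u_i,u_{i+1}\}$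 ($1\le i\le r-1$), $\{v_i,v_{i+1}\}$ ($1\le i\le s-1$), $\{w_i,w_{i+1}\}$ ($1\le i\le t-1$), $\{u_1,v_1\}$, $\{u_1,w_1\}$ and $\{v_1,w_1\}$. (a) If $G\in\mathcal T_3$ and $n>3$, then $$H(S/J_G,t)=\frac{1}{(1-t)^{n+2}}\,(1+2t-2t^3)(1+t)^{n-4}.$$ (b) If $G\in\mathcal G_3$ and $n>2$, then $$H(S/J_G,t)=\frac{1}{(1-t)^{n+1}}\,(1+2t)(1+t)^{n-3}.$$ -/

import Mathlib

open MvPolynomial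

/-- The polynomial ring `S = K[x_v, y_v : v ∈ V]`: `X (Sum.inl v)` is the variable `x_v`
and `X (Sum.inr v)` is the variable `y_v`. -/
abbrev EdgeRing (V K : Type*) [CommRing K] : Type _ := MvPolynomial (V ⊕ V) K

/-- The binomial edge ideal `J_G ⊆ S`: the ideal generated by all binomials
`x_i y_j - x_j y_i` with `i < j` and `{i, j}` an edge of `G`. -/
noncomputable def SimpleGraph.binomialEdgeIdeal {V : Type*} [LinearOrder V] (G : SimpleGraph V)
    (K : Type*) [CommRing K] : Ideal (EdgeRing V K) :=
  Ideal.span {f | ∃ i j : V, i < j ∧ G.Adj i j ∧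
    f = X (Sum.inl i) * X (Sum.inr j) - X (Sum.inl j) * X (Sum.inr i)}

/-- The degree `d` part `(S/I)_d` of a quotient of a standard graded polynomial ring: the
`K`-subspace of residue classes of homogeneous polynomials of degree `d`. -/
noncomputable def gradedPart {σ K : Type*} [Field K] (I : Ideal (MvPolynomial σ K)) (d : ℕ) :
    Submodule K (MvPolynomial σ K ⧸ I) :=
  (homogeneousSubmodule σ K d).map (Ideal.Quotient.mkₐ K I).toLinearMap

/-- The Hilbert series `H(S/I, t) = ∑_d dim_K (S/I)_d t^d`, as a formal power series over `ℚ`,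
of the quotient of a polynomial ring in finitely many variables by a homogeneous ideal `I`. -/
noncomputable def hilbertSeries {σ K : Type*} [Finite σ] [Field K]
    (I : Ideal (MvPolynomial σ K)) : PowerSeries ℚ :=
  PowerSeries.mk fun d => (Module.finrank K (gradedPart I d) : ℚ)

/-- The set of edges of the path `a 0, a 1, …, a (m - 1)`. -/
def pathEdges {V : Type*} {m : ℕ} (a : Fin m → V) : Set (Sym2 V) :=
  {e | ∃ (i : ℕ) (hi : i + 1 < m), e = s(a ⟨i, by omega⟩, a ⟨i + 1, hi⟩)}

/-- `G ∈ 𝒯₃`: the vertices can be listed without repetition as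
`u_1, …, u_r, v_1, …, v_s, w_1, …, w_t` with `r ≥ 2`, `s ≥ 1`, `t ≥ 1` such that the edges are
those of the three paths `u`, `v`, `w` together with `{u_1, v_1}` and `{u_1, w_1}`.
(Indices start at `0` here.) -/
def SimpleGraph.IsT3 {V : Type*} (G : SimpleGraph V) : Prop :=
  ∃ (r s t : ℕ) (hr : 2 ≤ r) (hs : 1 ≤ s) (ht : 1 ≤ t)
    (u : Fin r → V) (v : Fin s → V) (w : Fin t → V),
    Function.Bijective (Sum.elim u (Sum.elim v w)) ∧
    G.edgeSet = pathEdges u ∪ pathEdges v ∪ pathEdges w ∪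
      {s(u ⟨0, by omega⟩, v ⟨0, hs⟩), s(u ⟨0, by omega⟩, w ⟨0, ht⟩)}

/-- `G ∈ 𝒢₃`: the vertices can be listed without repetition as
`u_1, …, u_r, v_1, …, v_s, w_1, …, w_t` with `r, s, t ≥ 1` such that the edges are those of the
three paths `u`, `v`, `w` together with `{u_1, v_1}`, `{u_1, w_1}` and `{v_1, w_1}`.
(Indices start at `0` here.) -/
def SimpleGraph.IsG3 {V : Type*} (G : SimpleGraph V) : Prop :=
  ∃ (r s t : ℕ) (hr : 1 ≤ r) (hs : 1 ≤ s) (ht : 1 ≤ t)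
    (u : Fin r → V) (v : Fin s → V) (w : Fin t → V),
    Function.Bijective (Sum.elim u (Sum.elim v w)) ∧
    G.edgeSet = pathEdges u ∪ pathEdges v ∪ pathEdges w ∪
      {s(u ⟨0, hr⟩, v ⟨0, hs⟩), s(u ⟨0, hr⟩, w ⟨0, ht⟩), s(v ⟨0, hs⟩, w ⟨0, ht⟩)}

/-! ### Nonzerodivisors modulo an ideal -/

section Regular

/-! Write E_ab for the binomial of an edge and H₀ for the Hilbert series of S. The graph is built
edge by edge, and each new generator is controlled by its colon ideal: H(S/(I + (f))) = H(S/I) - t^k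
H(S/(I : f)) for f of degree k (`hilbertSeries_sup_span`). If one endpoint of the new edge is a new
vertex and x of the other endpoint is regular, then the binomial is regular, and so is x of the new
vertex afterwards. Attaching a path therefore costs one factor 1 - t^2 per edge
(`hilbertSeries_sup_pathIdeal`).

Only two colon ideals are nontrivial. Let I be the ideal of a path through c with neighbours a, b of
c. Then I : E_ab is generated by x_c, y_c and the two pieces left after deleting c
(`mul_mem_doublePathIdeal_iff`), which gives the triangle I + (E_ab) its factor (1 + t)^2 - t^2 = 1
+ 2t. For a new vertex d, I : E_cd is this triangle ideal (`hcolon` in `hilbertSeries_spiderIdeal`),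
which gives (1 + t)^2 - t^2(1 + 2t) = 1 + 2t - 2t^3.

Both the second colon and the last path of a graph in 𝒢₃ need x_c to be regular modulo the triangle
ideal (`regularMod_left_triangleIdeal`). This is the hardest point. All regularity proofs are
elementary: set a free variable to zero and compare. -/

/-- `f` is a nonzerodivisor modulo the ideal `I`. -/
def RegularMod {S : Type*} [CommRing S] (I : Ideal S) (f : S) : Prop :=
  ∀ g, f * g ∈ I → g ∈ I

variable {S : Type*} [CommRing S] {I J : Ideal S} {f g h : S}

theorem mem_sup_span_singleton_iff : h ∈ I ⊔ Ideal.span {f} ↔ ∃ i ∈ I, ∃ g, h = i + g * f := by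
  rw [Submodule.mem_sup]
  constructor
  · rintro ⟨i, hi, y, hy, rfl⟩
    obtain ⟨g, rfl⟩ := Ideal.mem_span_singleton'.1 hy
    exact ⟨i, hi, g, rfl⟩
  · rintro ⟨i, hi, g, rfl⟩
    exact ⟨i, hi, _, Ideal.mem_span_singleton'.2 ⟨g, rfl⟩, rfl⟩

theorem RegularMod.mul (hf : RegularMod I f) (hg : RegularMod I g) : RegularMod I (f * g) :=
  fun p hp => hg _ (hf _ (by rwa [← mul_assoc]))

theorem RegularMod.congr (hf : RegularMod I f) (h : f - g ∈ I) : RegularMod I g := by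
  intro p hp
  apply hf
  have : f * p = (f - g) * p + g * p := by ring
  rw [this]
  exact I.add_mem (I.mul_mem_right _ h) hp

/-- If `(I + (ℓ)) : f ⊆ (I : f) + (ℓ)`, then `ℓ` stays regular after adding `f`. -/
theorem RegularMod.sup_span_of_colon {ℓ : S} (hℓ : RegularMod I ℓ)
    (hf : ∀ h, f * h ∈ I ⊔ Ideal.span {ℓ} → ∃ h', f * h' ∈ I ∧ ∃ k, h = h' + k * ℓ) :
    RegularMod (I ⊔ Ideal.span {f}) ℓ := by
  intro p hp
  obtain ⟨i, hi, h, e⟩ := mem_sup_span_singleton_iff.1 hp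
  obtain ⟨h', hh', k, rfl⟩ := hf h (mem_sup_span_singleton_iff.2
    ⟨-i, I.neg_mem hi, p, by linear_combination -e⟩)
  have : p - k * f ∈ I := hℓ _ (by
    have : ℓ * (p - k * f) = i + f * h' := by linear_combination e
    rw [this]
    exact I.add_mem hi hh')
  exact mem_sup_span_singleton_iff.2 ⟨_, this, k, by ring⟩

/-- Exchange in a regular sequence: if ℓ, f is regular modulo I, then ℓ is still regular after f.
The colon condition is immediate, since f times an element of I lies in I. -/
theorem RegularMod.sup_span {ℓ : S} (hℓ : RegularMod I ℓ)
    (hf : RegularMod (I ⊔ Ideal.span {ℓ}) f) : RegularMod (I ⊔ Ideal.span {f}) ℓ := by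
  refine hℓ.sup_span_of_colon fun h hh => ?_
  obtain ⟨i, hi, g, rfl⟩ := mem_sup_span_singleton_iff.1 (hf _ hh)
  exact ⟨i, I.mul_mem_left _ hi, g, rfl⟩

end Regular

/-! ### Setting a variable to zero; variables that are free modulo an ideal -/

section Kill

variable {σ K : Type*} [Field K]

open Classical in
/-- The substitution `X i ↦ 0`, fixing all other variables. -/
noncomputable def kill (i : σ) : MvPolynomial σ K →ₐ[K] MvPolynomial σ K :=
  aeval fun j => if j = i then 0 else X j

@[simp] theorem kill_X_self (i : σ) : kill i (X i : MvPolynomial σ K) = 0 := by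
  simp [kill]

theorem kill_X_of_ne {i j : σ} (h : j ≠ i) : kill i (X j : MvPolynomial σ K) = X j := by
  simp [kill, h]

theorem exists_eq_kill_add (i : σ) (p : MvPolynomial σ K) : ∃ q, p = kill i p + X i * q := by
  induction p using MvPolynomial.induction_on with
  | C a => exact ⟨0, by simp [kill]⟩
  | add p q hp hq =>
    obtain ⟨p', hp⟩ := hp
    obtain ⟨q', hq⟩ := hq
    exact ⟨p' + q', by rw [map_add]; linear_combination hp + hq⟩
  | mul_X p j hp =>
    obtain ⟨p', hp⟩ := hp
    by_cases h : j = i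
    · exact ⟨p, by simp [h, mul_comm]⟩
    · exact ⟨p' * X j, by rw [map_mul, kill_X_of_ne h]; linear_combination X j * hp⟩

theorem degreeOf_kill (i : σ) (p : MvPolynomial σ K) : degreeOf i (kill i p) = 0 := by
  induction p using MvPolynomial.induction_on with
  | C a => simp [kill]
  | add p q hp hq =>
    rw [map_add]
    have := degreeOf_add_le i (kill i p) (kill i q)
    omega
  | mul_X p j hp =>
    by_cases h : j = i
    · simp [h]
    · rw [map_mul, kill_X_of_ne h, degreeOf_mul_X_of_ne _ (Ne.symm h), hp]

/-- The variable `X i` is free modulo `I`: the ideal `I` is extended from the polynomial ring in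
the other variables. -/
structure FreeMod (I : Ideal (MvPolynomial σ K)) (i : σ) : Prop where
  kill_mem : ∀ p ∈ I, kill i p ∈ I
  regular : RegularMod I (X i)

variable {I : Ideal (MvPolynomial σ K)} {i : σ}

theorem freeMod_bot (i : σ) : FreeMod (⊥ : Ideal (MvPolynomial σ K)) i where
  kill_mem p hp := by simp_all
  regular p hp := by simp_all [X_ne_zero]

theorem FreeMod.sup_span (h : FreeMod I i) {f : MvPolynomial σ K} (hf : kill i f = f) :
    FreeMod (I ⊔ Ideal.span {f}) i where
  kill_mem p hp := by
    obtain ⟨q, hq, g, rfl⟩ := mem_sup_span_singleton_iff.1 hp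
    exact mem_sup_span_singleton_iff.2 ⟨_, h.kill_mem q hq, kill i g, by simp [hf]⟩
  regular p hp := by
    obtain ⟨q, hq, g, e⟩ := mem_sup_span_singleton_iff.1 hp
    obtain ⟨g', hg⟩ := exists_eq_kill_add i g
    have e' := congrArg (kill i) e
    simp only [map_mul, kill_X_self, zero_mul, map_add, hf] at e'
    refine mem_sup_span_singleton_iff.2 ⟨p - g' * f, h.regular _ ?_, g', by ring⟩
    -- Subtracting the equation at X i = 0 leaves a multiple of X i, which can be cancelled modulo
    -- I.
    have : X i * (p - g' * f) = q - kill i q := by linear_combination e + f * hg - e'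
    rw [this]
    exact I.sub_mem hq (h.kill_mem _ hq)

theorem FreeMod.sup_X (h : FreeMod I i) {j : σ} (hj : j ≠ i) :
    FreeMod (I ⊔ Ideal.span {X j}) i :=
  h.sup_span (kill_X_of_ne hj)

/-- If `f` restricts to a regular element on `X i = 0`, then it is regular. -/
theorem FreeMod.regularMod_of_kill (h : FreeMod I i) {f : MvPolynomial σ K}
    (hf : RegularMod I (kill i f)) : RegularMod I f := by
  -- Induction on the degree in X i: the part of p without X i lies in I by hypothesis, and dividing
  -- the rest by X i lowers the degree.
  suffices ∀ d p, degreeOf i p < d → f * p ∈ I → p ∈ I from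
    fun p => this _ p (Nat.lt_succ_self _)
  intro d
  induction d with
  | zero => intro p hp; omega
  | succ d ih =>
    intro p hd hp
    have hk : kill i p ∈ I := hf _ (by simpa using h.kill_mem _ hp)
    obtain ⟨q, hq⟩ := exists_eq_kill_add i p
    have hfq : f * q ∈ I := h.regular _ (by
      have : X i * (f * q) = f * p - f * kill i p := by linear_combination (-f) * hq
      rw [this]
      exact I.sub_mem hp (I.mul_mem_left _ hk))
    rw [hq]
    refine I.add_mem hk (I.mul_mem_left _ ?_)
    by_cases hq0 : q = 0
    · simp [hq0]
    refine ih q ?_ hfq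
    have h1 := (degreeOf_mul_X_eq_degreeOf_add_one_iff i q).2 hq0
    have h2 : q * X i = p + (-1 : K) • kill i p := by
      rw [neg_one_smul]; linear_combination -hq
    have h3 := degreeOf_add_le i p (C (-1 : K) * kill i p)
    have h4 := degreeOf_C_mul_le (kill i p) i (-1 : K)
    rw [h2, smul_eq_C_mul] at h1
    have h5 := degreeOf_kill i p
    omega

variable {a b : MvPolynomial σ K} {j : σ}

/-- At X i = 0 the binomial becomes a * X j, a product of two regular elements. -/
theorem FreeMod.regularMod_binomial (hi : FreeMod I i) (hj : FreeMod I j) (hij : j ≠ i)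
    (ha : kill i a = a) (hreg : RegularMod I a) : RegularMod I (a * X j - X i * b) := by
  apply hi.regularMod_of_kill
  simpa [ha, kill_X_of_ne hij] using hreg.mul hj.regular

/-- The first new variable is regular after attaching a pendant edge. -/
theorem FreeMod.regularMod_X_binomial (hi : FreeMod I i) (hj : FreeMod I j) (hij : j ≠ i)
    (ha : kill i a = a) (hab : ∀ h, a * h ∈ I → b * h ∈ I) :
    RegularMod (I ⊔ Ideal.span {a * X j - X i * b}) (X i) := by
  intro g hg
  obtain ⟨q, hq, h, e⟩ := mem_sup_span_singleton_iff.1 hg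
  obtain ⟨h', hh⟩ := exists_eq_kill_add i h
  have e' := congrArg (kill i) e
  simp only [map_mul, kill_X_self, zero_mul, map_add, map_sub, ha, kill_X_of_ne hij,
    sub_zero] at e'
  -- At X i = 0 the relation reads 0 = q₀ + h₀ * a * X j with q₀ in I, so the free variable X j
  -- cancels. Then `hab` also puts b * h₀ in I, and what remains is divisible by X i.
  have h1 : a * kill i h ∈ I := hj.regular _ (by
    have : X j * (a * kill i h) = - kill i q := by linear_combination -e'
    rw [this]
    exact I.neg_mem (hi.kill_mem _ hq))
  have h2 := hab _ h1
  refine mem_sup_span_singleton_iff.2 ⟨g - h' * (a * X j - X i * b), hi.regular _ ?_, h', by ring⟩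
  have : X i * (g - h' * (a * X j - X i * b)) =
      q + X j * (a * kill i h) - X i * (b * kill i h) := by
    linear_combination e + (a * X j - X i * b) * hh
  rw [this]
  exact I.sub_mem (I.add_mem hq (I.mul_mem_left _ h1)) (I.mul_mem_left _ h2)

end Kill

/-! ### Hilbert series and colon ideals -/

section Hilbert

variable {σ K : Type*} [Field K]

theorem homogeneousComponent_mul_of_isHomogeneous {f : MvPolynomial σ K} {k : ℕ}
    (hf : f.IsHomogeneous k) (g : MvPolynomial σ K) (d : ℕ) :
    homogeneousComponent d (g * f) =
      if k ≤ d then homogeneousComponent (d - k) g * f else 0 := by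
  have key : ∀ e, homogeneousComponent d (homogeneousComponent e g * f) =
      if d = e + k then homogeneousComponent e g * f else 0 := fun e =>
    homogeneousComponent_of_mem ((homogeneousComponent_isHomogeneous e g).mul hf)
  conv_lhs => rw [← sum_homogeneousComponent g]
  rw [Finset.sum_mul, map_sum, Finset.sum_congr rfl fun e _ => key e]
  split_ifs with h
  · have hd : ∀ e, d = e + k ↔ e = d - k := fun e => by omega
    simp only [hd]
    rw [Finset.sum_ite_eq']
    split_ifs with h2
    · rfl
    · rw [homogeneousComponent_eq_zero, zero_mul]
      have := Finset.mem_range.not.1 h2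
      omega
  · exact Finset.sum_eq_zero fun e _ => if_neg (by omega)

/-- The ideal `I` contains the homogeneous components of its elements. -/
def IsHomogeneousIdeal (I : Ideal (MvPolynomial σ K)) : Prop :=
  ∀ p ∈ I, ∀ d, homogeneousComponent d p ∈ I

variable {I J : Ideal (MvPolynomial σ K)} {f : MvPolynomial σ K} {k : ℕ}

theorem isHomogeneousIdeal_bot : IsHomogeneousIdeal (⊥ : Ideal (MvPolynomial σ K)) := by
  intro p hp d
  simp_all

theorem IsHomogeneousIdeal.sup (hI : IsHomogeneousIdeal I) (hJ : IsHomogeneousIdeal J) :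
    IsHomogeneousIdeal (I ⊔ J) := by
  intro p hp d
  obtain ⟨i, hi, j, hj, rfl⟩ := Submodule.mem_sup.1 hp
  rw [map_add]
  exact Submodule.add_mem_sup (hI i hi d) (hJ j hj d)

theorem isHomogeneousIdeal_span (hf : f.IsHomogeneous k) :
    IsHomogeneousIdeal (Ideal.span {f}) := by
  intro p hp d
  obtain ⟨g, rfl⟩ := Ideal.mem_span_singleton'.1 hp
  rw [homogeneousComponent_mul_of_isHomogeneous hf]
  split_ifs
  · exact Ideal.mul_mem_left _ _ (Ideal.mem_span_singleton_self f)
  · exact Ideal.zero_mem _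

theorem mem_gradedPart {d : ℕ} {x : MvPolynomial σ K ⧸ I} :
    x ∈ gradedPart I d ↔ ∃ p, p.IsHomogeneous d ∧ Ideal.Quotient.mk I p = x :=
  Submodule.mem_map

/-- The ideal generated by a list of variables. -/
noncomputable def varIdeal (K : Type*) [Field K] : List σ → Ideal (MvPolynomial σ K)
  | [] => ⊥
  | i :: l => varIdeal K l ⊔ Ideal.span {X i}

theorem isHomogeneousIdeal_varIdeal (l : List σ) : IsHomogeneousIdeal (varIdeal K l) := by
  induction l with
  | nil => exact isHomogeneousIdeal_bot
  | cons i l ih => exact ih.sup (isHomogeneousIdeal_span (isHomogeneous_X K i))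

theorem freeMod_varIdeal {l : List σ} {i : σ} (hi : i ∉ l) : FreeMod (varIdeal K l) i := by
  induction l with
  | nil => exact freeMod_bot i
  | cons j l ih =>
    rw [List.mem_cons, not_or] at hi
    exact (ih hi.2).sup_X (Ne.symm hi.1)

theorem X_mem_varIdeal {l : List σ} {i : σ} (hi : i ∈ l) :
    (X i : MvPolynomial σ K) ∈ varIdeal K l := by
  induction l with
  | nil => simp at hi
  | cons j l ih =>
    rcases List.mem_cons.1 hi with rfl | h
    · exact Ideal.mem_sup_right (Ideal.mem_span_singleton_self _)
    · exact Ideal.mem_sup_left (ih h)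

theorem varIdeal_le_iff {l : List σ} {J : Ideal (MvPolynomial σ K)} :
    varIdeal K l ≤ J ↔ ∀ i ∈ l, X i ∈ J := by
  induction l with
  | nil => simp [varIdeal]
  | cons j l ih => simp [varIdeal, ih, and_comm]

theorem finrank_gradedPart_of_lt (hI : IsHomogeneousIdeal I) (hf : f.IsHomogeneous k)
    {d : ℕ} (hd : d < k) :
    Module.finrank K (gradedPart (I ⊔ Ideal.span {f}) d) = Module.finrank K (gradedPart I d) := by
  let φ : (MvPolynomial σ K ⧸ I) →ₗ[K] (MvPolynomial σ K ⧸ I ⊔ Ideal.span {f}) :=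
    (Ideal.Quotient.factorₐ K (le_sup_left : I ≤ I ⊔ Ideal.span {f})).toLinearMap
  have h1 : (gradedPart I d).map φ = gradedPart (I ⊔ Ideal.span {f}) d := by
    ext x
    rw [Submodule.mem_map, mem_gradedPart]
    constructor
    · rintro ⟨y, hy, rfl⟩
      obtain ⟨p, hp, rfl⟩ := mem_gradedPart.1 hy
      exact ⟨p, hp, rfl⟩
    · rintro ⟨p, hp, rfl⟩
      exact ⟨_, mem_gradedPart.2 ⟨p, hp, rfl⟩, rfl⟩
  rw [← h1]
  rw [← LinearMap.range_domRestrict]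
  refine LinearMap.finrank_range_of_inj ?_
  rintro ⟨x, hx⟩ ⟨y, hy⟩ hxy
  obtain ⟨p, hp, rfl⟩ := mem_gradedPart.1 hx
  obtain ⟨q, hq, rfl⟩ := mem_gradedPart.1 hy
  have hpq : p - q ∈ I ⊔ Ideal.span {f} := Ideal.Quotient.eq.1 hxy
  obtain ⟨i, hi, g, e1⟩ := mem_sup_span_singleton_iff.1 hpq
  have e2 := congrArg (homogeneousComponent d) e1
  rw [homogeneousComponent_eq_self (hp.sub hq), map_add,
    homogeneousComponent_mul_of_isHomogeneous hf, if_neg (by omega), add_zero] at e2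
  refine Subtype.ext (Ideal.Quotient.eq.2 ?_)
  rw [e2]
  exact hI _ hi _

variable [Finite σ]

instance (d : ℕ) : FiniteDimensional K (homogeneousSubmodule σ K d) := by
  refine Submodule.finiteDimensional_of_le (S₂ := restrictTotalDegree σ K d) fun p hp => ?_
  rw [mem_restrictTotalDegree]
  exact ((mem_homogeneousSubmodule d p).1 hp).totalDegree_le

instance (I : Ideal (MvPolynomial σ K)) (d : ℕ) : FiniteDimensional K (gradedPart I d) := by
  unfold gradedPart
  infer_instance

/-- The kernel of `(S/I)_d → (S/(I + (f)))_d` is the multiplication by `f` image of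
`(S/J)_e`, where `J = I : f` and `d = e + deg f`. -/
theorem finrank_gradedPart_add (hI : IsHomogeneousIdeal I) (hf : f.IsHomogeneous k)
    (hJ : ∀ h, f * h ∈ I ↔ h ∈ J) (e : ℕ) :
    Module.finrank K (gradedPart (I ⊔ Ideal.span {f}) (e + k)) +
      Module.finrank K (gradedPart J e) = Module.finrank K (gradedPart I (e + k)) := by
  let φ : (MvPolynomial σ K ⧸ I) →ₗ[K] (MvPolynomial σ K ⧸ I ⊔ Ideal.span {f}) :=
    (Ideal.Quotient.factorₐ K (le_sup_left : I ≤ I ⊔ Ideal.span {f})).toLinearMap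
  let φ' := φ.domRestrict (gradedPart I (e + k))
  let W := homogeneousSubmodule σ K e
  let θ : W →ₗ[K] (MvPolynomial σ K ⧸ I) :=
    ((Ideal.Quotient.mkₐ K I).toLinearMap ∘ₗ LinearMap.mulLeft K f).domRestrict W
  have hθ : ∀ g : W, θ g = Ideal.Quotient.mk I (f * g) := fun g => rfl
  let π : W →ₗ[K] (MvPolynomial σ K ⧸ J) := (Ideal.Quotient.mkₐ K J).toLinearMap.domRestrict W
  have hπ : ∀ g : W, π g = Ideal.Quotient.mk J g := fun g => rfl
  have h1 : LinearMap.range φ' = gradedPart (I ⊔ Ideal.span {f}) (e + k) := by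
    ext x
    rw [LinearMap.mem_range, mem_gradedPart]
    constructor
    · rintro ⟨⟨y, hy⟩, rfl⟩
      obtain ⟨p, hp, rfl⟩ := mem_gradedPart.1 hy
      exact ⟨p, hp, rfl⟩
    · rintro ⟨p, hp, rfl⟩
      exact ⟨⟨_, mem_gradedPart.2 ⟨p, hp, rfl⟩⟩, rfl⟩
  have h2 : LinearMap.range π = gradedPart J e := by
    rw [gradedPart]
    exact LinearMap.range_domRestrict _ _
  have h3 : LinearMap.ker π = LinearMap.ker θ := by
    ext g
    rw [LinearMap.mem_ker, LinearMap.mem_ker, hπ, hθ, Ideal.Quotient.eq_zero_iff_mem,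
      Ideal.Quotient.eq_zero_iff_mem, hJ]
  -- Exactness in the middle: a class of degree e + k that dies modulo f is f times a class of
  -- degree e, found by taking homogeneous components.
  have h4 : (LinearMap.ker φ').map (gradedPart I (e + k)).subtype = LinearMap.range θ := by
    ext x
    rw [Submodule.mem_map, LinearMap.mem_range]
    constructor
    · rintro ⟨⟨y, hy⟩, hker, rfl⟩
      obtain ⟨p, hp, rfl⟩ := mem_gradedPart.1 hy
      have hp' : p ∈ I ⊔ Ideal.span {f} := by
        rw [← Ideal.Quotient.eq_zero_iff_mem]
        exact hker
      obtain ⟨i, hi, g, e1⟩ := mem_sup_span_singleton_iff.1 hp'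
      have e2 := congrArg (homogeneousComponent (e + k)) e1
      rw [homogeneousComponent_eq_self hp, map_add,
        homogeneousComponent_mul_of_isHomogeneous hf, if_pos (by omega),
        Nat.add_sub_cancel] at e2
      refine ⟨⟨homogeneousComponent e g, homogeneousComponent_mem e g⟩, ?_⟩
      rw [hθ]
      refine Ideal.Quotient.eq.2 ?_
      have : f * homogeneousComponent e g - p = -homogeneousComponent (e + k) i := by
        linear_combination -e2
      rw [this]
      exact I.neg_mem (hI _ hi _)
    · rintro ⟨⟨g, hg⟩, rfl⟩
      have hfg : (f * g).IsHomogeneous (e + k) := by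
        rw [mul_comm]
        exact ((mem_homogeneousSubmodule e g).1 hg).mul hf
      refine ⟨⟨_, mem_gradedPart.2 ⟨f * g, hfg, rfl⟩⟩, ?_, rfl⟩
      refine Ideal.Quotient.eq_zero_iff_mem.2 ?_
      exact Ideal.mem_sup_right (Ideal.mul_mem_right _ _ (Ideal.mem_span_singleton_self f))
  have r1 := LinearMap.finrank_range_add_finrank_ker φ'
  have r2 := LinearMap.finrank_range_add_finrank_ker π
  have r3 := LinearMap.finrank_range_add_finrank_ker θ
  rw [h1] at r1
  rw [h2, h3] at r2
  rw [← h4, LinearEquiv.finrank_eq (Submodule.equivMapOfInjective _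
    (Submodule.subtype_injective _) _).symm] at r3
  omega

/-- Dimension count in the exact sequence 0 → (S/J)(-k) → S/I → S/(I + (f)) → 0, where J = I : f and
the first map is multiplication by f. -/
theorem hilbertSeries_sup_span (hI : IsHomogeneousIdeal I) (hf : f.IsHomogeneous k)
    (hJ : ∀ h, f * h ∈ I ↔ h ∈ J) :
    hilbertSeries (I ⊔ Ideal.span {f}) =
      hilbertSeries I - PowerSeries.X ^ k * hilbertSeries J := by
  ext d
  rw [map_sub, PowerSeries.coeff_X_pow_mul']
  simp only [hilbertSeries, PowerSeries.coeff_mk]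
  split_ifs with h
  · obtain ⟨e, rfl⟩ := Nat.exists_eq_add_of_le' h
    rw [← finrank_gradedPart_add hI hf hJ e]
    rw [Nat.add_sub_cancel]
    push_cast
    ring
  · rw [finrank_gradedPart_of_lt hI hf (not_le.1 h), sub_zero]

theorem hilbertSeries_sup_span_of_regularMod (hI : IsHomogeneousIdeal I)
    (hf : f.IsHomogeneous k) (hreg : RegularMod I f) :
    hilbertSeries (I ⊔ Ideal.span {f}) = (1 - PowerSeries.X ^ k) * hilbertSeries I := by
  rw [hilbertSeries_sup_span hI hf fun h => ⟨hreg h, I.mul_mem_left _⟩]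
  ring

theorem hilbertSeries_varIdeal {l : List σ} (hl : l.Nodup) :
    hilbertSeries (varIdeal K l) =
      (1 - PowerSeries.X) ^ l.length * hilbertSeries (⊥ : Ideal (MvPolynomial σ K)) := by
  induction l with
  | nil => simp [varIdeal]
  | cons i l ih =>
    rw [List.nodup_cons] at hl
    rw [varIdeal, hilbertSeries_sup_span_of_regularMod (isHomogeneousIdeal_varIdeal l)
      (isHomogeneous_X K i) (freeMod_varIdeal hl.1).regular, ih hl.2, List.length_cons]
    ring

theorem hilbertSeries_varIdeal_of_forall_mem {l : List σ} (hl : ∀ i, i ∈ l) :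
    hilbertSeries (varIdeal K l) = 1 := by
  have hle : varIdeal K l ≤ RingHom.ker (constantCoeff (σ := σ) (R := K)) :=
    varIdeal_le_iff.2 fun i _ => by simp [RingHom.mem_ker]
  ext d
  rw [hilbertSeries, PowerSeries.coeff_mk, PowerSeries.coeff_one]
  split_ifs with hd
  · subst hd
    norm_cast
    rw [finrank_eq_one_iff']
    refine ⟨⟨_, mem_gradedPart.2 ⟨1, isHomogeneous_one σ K, rfl⟩⟩, ?_, ?_⟩
    · intro h
      have h1 : (1 : MvPolynomial σ K) ∈ varIdeal K l :=
        Ideal.Quotient.eq_zero_iff_mem.1 (congrArg Subtype.val h)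
      simpa [RingHom.mem_ker] using hle h1
    · rintro ⟨x, hx⟩
      obtain ⟨p, hp, rfl⟩ := mem_gradedPart.1 hx
      refine ⟨coeff 0 p, Subtype.ext ?_⟩
      have hp' : p = C (coeff 0 p) := by
        rw [← homogeneousComponent_zero, homogeneousComponent_eq_self hp]
      refine Eq.trans ?_ (congrArg (Ideal.Quotient.mk (varIdeal K l)) hp'.symm)
      rw [← mul_one (C _), ← smul_eq_C_mul]
      rfl
  · norm_cast
    rw [Submodule.finrank_eq_zero, eq_bot_iff]
    intro x hx
    obtain ⟨p, hp, rfl⟩ := mem_gradedPart.1 hx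
    refine Ideal.Quotient.eq_zero_iff_mem.2 ?_
    rw [p.as_sum]
    refine Ideal.sum_mem _ fun m hm => ?_
    have hm0 : m ≠ 0 := by
      rintro rfl
      have := hp (mem_support_iff.1 hm)
      simp at this
      exact hd this.symm
    obtain ⟨i, hi⟩ := Finsupp.ne_iff.1 hm0
    obtain ⟨q, hq⟩ := (X_dvd_monomial (r := coeff m p)).2 (Or.inr hi)
    rw [hq]
    exact Ideal.mul_mem_right _ _ (X_mem_varIdeal (hl i))

/-- The variables form a regular sequence with quotient K, so no monomials need to be counted. -/
theorem hilbertSeries_bot_mul :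
    (1 - PowerSeries.X) ^ Nat.card σ * hilbertSeries (⊥ : Ideal (MvPolynomial σ K)) = 1 := by
  have := Fintype.ofFinite σ
  have h := hilbertSeries_varIdeal (K := K) (Finset.nodup_toList (Finset.univ : Finset σ))
  rw [hilbertSeries_varIdeal_of_forall_mem (by simp), Finset.length_toList, Finset.card_univ] at h
  rw [Nat.card_eq_fintype_card, ← h]

end Hilbert

/-! ### Edge binomials and attaching paths -/

section Path

variable {V σ : Type*} (K : Type*) [Field K]

/-- The binomial `x_a y_b - x_b y_a`, where `p` and `q` index the variables `x` and `y`. -/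
noncomputable def edgeBinomial (p q : V → σ) (a b : V) : MvPolynomial σ K :=
  X (p a) * X (q b) - X (p b) * X (q a)

/-- The ideal generated by the binomials of the consecutive pairs of a list of vertices. -/
noncomputable def pathIdeal (p q : V → σ) : List V → Ideal (MvPolynomial σ K)
  | [] => ⊥
  | [_] => ⊥
  | a :: b :: l => Ideal.span {edgeBinomial K p q a b} ⊔ pathIdeal p q (b :: l)

variable (p q : V → σ)

theorem edgeBinomial_swap (a b : V) : edgeBinomial K q p a b = -edgeBinomial K p q a b := by
  simp only [edgeBinomial]
  ring

theorem edgeBinomial_comm (a b : V) : edgeBinomial K p q b a = -edgeBinomial K p q a b := by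
  simp only [edgeBinomial]
  ring

theorem span_edgeBinomial_comm (a b : V) :
    Ideal.span {edgeBinomial K p q b a} = Ideal.span {edgeBinomial K p q a b} := by
  rw [edgeBinomial_comm, Ideal.span_singleton_neg]

theorem pathIdeal_swap (l : List V) : pathIdeal K q p l = pathIdeal K p q l := by
  induction l with
  | nil => rfl
  | cons a l ih =>
    cases l with
    | nil => rfl
    | cons b l => rw [pathIdeal, pathIdeal, ih, edgeBinomial_swap, Ideal.span_singleton_neg]

theorem isHomogeneous_edgeBinomial (a b : V) : (edgeBinomial K p q a b).IsHomogeneous 2 :=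
  ((isHomogeneous_X K _).mul (isHomogeneous_X K _)).sub
    ((isHomogeneous_X K _).mul (isHomogeneous_X K _))

theorem isHomogeneousIdeal_pathIdeal (l : List V) : IsHomogeneousIdeal (pathIdeal K p q l) := by
  induction l with
  | nil => exact isHomogeneousIdeal_bot
  | cons a l ih =>
    cases l with
    | nil => exact isHomogeneousIdeal_bot
    | cons b l => exact (isHomogeneousIdeal_span (isHomogeneous_edgeBinomial K p q a b)).sup ih

theorem pathIdeal_le_iff (l : List V) (J : Ideal (MvPolynomial σ K)) :
    pathIdeal K p q l ≤ J ↔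
      ∀ (i : ℕ) (hi : i + 1 < l.length), edgeBinomial K p q l[i] l[i + 1] ∈ J := by
  induction l with
  | nil => simp [pathIdeal]
  | cons a l ih =>
    cases l with
    | nil => simp [pathIdeal]
    | cons b l =>
      rw [pathIdeal, sup_le_iff, ih, Ideal.span_singleton_le_iff_mem]
      constructor
      · rintro ⟨h0, h⟩ (_ | i) hi
        · exact h0
        · exact h i (by simpa using hi)
      · intro h
        exact ⟨h 0 (by simp), fun i hi => h (i + 1) (by simpa using hi)⟩

variable {K p q} {I : Ideal (MvPolynomial σ K)} {a b v : V} {l : List V}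

theorem injective_sum_elim_swap {p q : V → σ} (hpq : Function.Injective (Sum.elim p q)) :
    Function.Injective (Sum.elim q p) := by
  rw [← Sum.elim_swap]
  exact hpq.comp Sum.swap_leftInverse.injective

/-- Both variables of the vertex `v` are free modulo `I`. -/
structure VertexFree (p q : V → σ) (I : Ideal (MvPolynomial σ K)) (v : V) : Prop where
  left : FreeMod I (p v)
  right : FreeMod I (q v)

theorem VertexFree.swap (h : VertexFree p q I v) : VertexFree q p I v := ⟨h.2, h.1⟩

theorem vertexFree_bot : VertexFree p q (⊥ : Ideal (MvPolynomial σ K)) v :=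
  ⟨freeMod_bot _, freeMod_bot _⟩

theorem left_ne_left (hpq : Function.Injective (Sum.elim p q)) (h : a ≠ b) : p a ≠ p b := fun e =>
  h (Sum.inl_injective (hpq (a₁ := .inl a) (a₂ := .inl b) e))

theorem right_ne_right (hpq : Function.Injective (Sum.elim p q)) (h : a ≠ b) : q a ≠ q b := fun e =>
  h (Sum.inr_injective (hpq (a₁ := .inr a) (a₂ := .inr b) e))

theorem left_ne_right (hpq : Function.Injective (Sum.elim p q)) (a b : V) : p a ≠ q b := fun e =>
  Sum.inl_ne_inr (hpq (a₁ := .inl a) (a₂ := .inr b) e)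

theorem kill_left_edgeBinomial (hpq : Function.Injective (Sum.elim p q)) (ha : a ≠ v)
    (hb : b ≠ v) : kill (p v) (edgeBinomial K p q a b) = edgeBinomial K p q a b := by
  simp [edgeBinomial, kill_X_of_ne (left_ne_left hpq ha), kill_X_of_ne (left_ne_left hpq hb),
    kill_X_of_ne (left_ne_right hpq v _).symm]

theorem kill_right_edgeBinomial (hpq : Function.Injective (Sum.elim p q)) (ha : a ≠ v)
    (hb : b ≠ v) : kill (q v) (edgeBinomial K p q a b) = edgeBinomial K p q a b := by
  have h := kill_left_edgeBinomial (K := K) (injective_sum_elim_swap hpq) ha hb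
  rwa [edgeBinomial_swap, map_neg, neg_inj] at h

theorem VertexFree.sup_edgeBinomial (hpq : Function.Injective (Sum.elim p q))
    (h : VertexFree p q I v) (ha : a ≠ v) (hb : b ≠ v) :
    VertexFree p q (I ⊔ Ideal.span {edgeBinomial K p q a b}) v :=
  ⟨h.1.sup_span (kill_left_edgeBinomial hpq ha hb),
    h.2.sup_span (kill_right_edgeBinomial hpq ha hb)⟩

theorem FreeMod.sup_pathIdeal_left (hpq : Function.Injective (Sum.elim p q))
    (h : FreeMod I (p v)) (hv : v ∉ l) : FreeMod (I ⊔ pathIdeal K p q l) (p v) := by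
  induction l generalizing I with
  | nil => simpa [pathIdeal] using h
  | cons a l ih =>
    cases l with
    | nil => simpa [pathIdeal] using h
    | cons b l =>
      simp only [List.mem_cons, not_or] at hv ih
      rw [pathIdeal, ← sup_assoc]
      exact ih (h.sup_span (kill_left_edgeBinomial hpq (Ne.symm hv.1) (Ne.symm hv.2.1))) hv.2

theorem FreeMod.sup_pathIdeal_right (hpq : Function.Injective (Sum.elim p q))
    (h : FreeMod I (q v)) (hv : v ∉ l) : FreeMod (I ⊔ pathIdeal K p q l) (q v) := by
  rw [← pathIdeal_swap]
  exact h.sup_pathIdeal_left (injective_sum_elim_swap hpq) hv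

theorem VertexFree.sup_pathIdeal (hpq : Function.Injective (Sum.elim p q))
    (h : VertexFree p q I v) (hv : v ∉ l) : VertexFree p q (I ⊔ pathIdeal K p q l) v :=
  ⟨h.1.sup_pathIdeal_left hpq hv, h.2.sup_pathIdeal_right hpq hv⟩

theorem vertexFree_varIdeal {l : List σ} (hp : p v ∉ l) (hq : q v ∉ l) :
    VertexFree p q (varIdeal K l) v :=
  ⟨freeMod_varIdeal hp, freeMod_varIdeal hq⟩

theorem VertexFree.regularMod_edgeBinomial (hpq : Function.Injective (Sum.elim p q))
    (hb : VertexFree p q I b) (hab : a ≠ b) (ha : RegularMod I (X (p a))) :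
    RegularMod I (edgeBinomial K p q a b) :=
  hb.1.regularMod_binomial hb.2 (left_ne_right hpq _ _).symm
    (kill_X_of_ne (left_ne_left hpq hab)) ha

theorem VertexFree.regularMod_left_of_pendant (hpq : Function.Injective (Sum.elim p q))
    (hb : VertexFree p q I b) (hab : a ≠ b)
    (ha : ∀ h, X (p a) * h ∈ I → X (q a) * h ∈ I) :
    RegularMod (I ⊔ Ideal.span {edgeBinomial K p q a b}) (X (p b)) :=
  hb.1.regularMod_X_binomial hb.2 (left_ne_right hpq _ _).symm
    (kill_X_of_ne (left_ne_left hpq hab)) ha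

/-- The path is built from its far end, so that `a` is always the new pendant vertex. The pendant
condition holds because x of the previous head is already regular. -/
theorem regularMod_head (hpq : Function.Injective (Sum.elim p q)) (hl : (a :: l).Nodup)
    (hfree : ∀ v ∈ a :: l, VertexFree p q I v) :
    RegularMod (I ⊔ pathIdeal K p q (a :: l)) (X (p a)) := by
  induction l generalizing a with
  | nil => simpa [pathIdeal] using (hfree a (by simp)).1.regular
  | cons b l ih =>
    rw [List.nodup_cons] at hl
    have hb := ih hl.2 fun v hv => hfree v (List.mem_cons_of_mem _ hv)
    have hba : b ≠ a := fun h => hl.1 (by simp [h])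
    rw [pathIdeal, ← span_edgeBinomial_comm, sup_comm (Ideal.span _), ← sup_assoc]
    exact ((hfree a (by simp)).sup_pathIdeal hpq hl.1).regularMod_left_of_pendant hpq hba
      fun h hh => Ideal.mul_mem_left _ _ (hb h hh)

/-- Regularity travels along the path: x_a regular makes E_ab regular, and then x_b is regular
modulo the enlarged ideal. Each edge contributes 1 - t^2. -/
theorem hilbertSeries_sup_pathIdeal [Finite σ] (hpq : Function.Injective (Sum.elim p q))
    (hl : (a :: l).Nodup) (hfree : ∀ v ∈ l, VertexFree p q I v)
    (ha : RegularMod I (X (p a))) (hI : IsHomogeneousIdeal I) :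
    hilbertSeries (I ⊔ pathIdeal K p q (a :: l)) =
      (1 - PowerSeries.X ^ 2) ^ l.length * hilbertSeries I := by
  induction l generalizing a I with
  | nil => simp [pathIdeal]
  | cons b l ih =>
    rw [List.nodup_cons] at hl
    have hab : a ≠ b := fun h => hl.1 (by simp [h])
    have hE := isHomogeneous_edgeBinomial K p q a b
    have hb := hfree b (by simp)
    rw [pathIdeal, ← sup_assoc, ih hl.2 ?_ ?_ (hI.sup (isHomogeneousIdeal_span hE)),
      hilbertSeries_sup_span_of_regularMod hI hE (hb.regularMod_edgeBinomial hpq hab ha),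
      List.length_cons]
    · ring
    · intro v hv
      refine (hfree v (List.mem_cons_of_mem _ hv)).sup_edgeBinomial hpq ?_ ?_
      · rintro rfl
        exact hl.1 (List.mem_cons_of_mem _ hv)
      · rintro rfl
        exact (List.nodup_cons.1 hl.2).1 hv
    · exact hb.regularMod_left_of_pendant hpq hab fun h hh => Ideal.mul_mem_left _ _ (ha h hh)

/-- Attaching a path at `a` keeps `f` regular if `x_a` is regular modulo `I + (f)`. -/
theorem RegularMod.sup_pathIdeal (hpq : Function.Injective (Sum.elim p q))
    {f : MvPolynomial σ K} (hf : RegularMod I f) (hl : (a :: l).Nodup)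
    (hfree : ∀ v ∈ l, VertexFree p q (I ⊔ Ideal.span {f}) v)
    (ha : RegularMod (I ⊔ Ideal.span {f}) (X (p a))) :
    RegularMod (I ⊔ pathIdeal K p q (a :: l)) f := by
  induction l generalizing a I with
  | nil => simpa [pathIdeal] using hf
  | cons b l ih =>
    rw [List.nodup_cons] at hl
    have hab : a ≠ b := fun h => hl.1 (by simp [h])
    have hb := hfree b (by simp)
    rw [pathIdeal, ← sup_assoc]
    -- E_ab is regular modulo I + (f), so the exchange lemma keeps f regular modulo I + (E_ab).
    refine ih (hf.sup_span (hb.regularMod_edgeBinomial hpq hab ha)) hl.2 ?_ ?_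
    · intro v hv
      rw [sup_right_comm]
      refine (hfree v (List.mem_cons_of_mem _ hv)).sup_edgeBinomial hpq ?_ ?_
      · rintro rfl
        exact hl.1 (List.mem_cons_of_mem _ hv)
      · rintro rfl
        exact (List.nodup_cons.1 hl.2).1 hv
    · rw [sup_right_comm]
      exact hb.regularMod_left_of_pendant hpq hab fun h hh => Ideal.mul_mem_left _ _ (ha h hh)

end Path

/-! ### Paths through a vertex c, and closing a triangle -/

section Spider

variable {V σ K : Type*} [Field K] {p q : V → σ} {a b c d : V} {A B D : List V}

theorem sup_span_mono_of_add_mem {S : Type*} [CommRing S] {I : Ideal S} {f g : S}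
    (h : f + g ∈ I) : I ⊔ Ideal.span {f} ≤ I ⊔ Ideal.span {g} := by
  refine sup_le le_sup_left ((Ideal.span_singleton_le_iff_mem _).2 ?_)
  exact mem_sup_span_singleton_iff.2 ⟨_, h, -1, by ring⟩

theorem sup_span_congr_of_add_mem {S : Type*} [CommRing S] {I : Ideal S} {f g : S}
    (h : f + g ∈ I) : I ⊔ Ideal.span {f} = I ⊔ Ideal.span {g} :=
  le_antisymm (sup_span_mono_of_add_mem h) (sup_span_mono_of_add_mem (by rwa [add_comm]))

/-- Split g = g₀ + X i * g'. At X i = 0 one gets f * g₀ ∈ I, hence g₀ ∈ I. Cancelling X i from the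
rest gives f * g' ∈ I + (u, v), hence g' ∈ I + (u, v), and multiplying by X i returns to the
original ideal. -/
theorem FreeMod.regularMod_sup_mul {I : Ideal (MvPolynomial σ K)} {i : σ} (hi : FreeMod I i)
    {f u v : MvPolynomial σ K} (hf : kill i f = f) (hfI : RegularMod I f)
    (hfuv : RegularMod (I ⊔ Ideal.span {u} ⊔ Ideal.span {v}) f) :
    RegularMod (I ⊔ Ideal.span {X i * u} ⊔ Ideal.span {X i * v}) f := by
  intro g hg
  obtain ⟨w, hw, s, e⟩ := mem_sup_span_singleton_iff.1 hg
  obtain ⟨m, hm, r, rfl⟩ := mem_sup_span_singleton_iff.1 hw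
  obtain ⟨g', hg'⟩ := exists_eq_kill_add i g
  have e' := congrArg (kill i) e
  simp only [map_mul, kill_X_self, zero_mul, mul_zero, add_zero, map_add, hf] at e'
  have hk : kill i g ∈ I := hfI _ (by rw [e']; exact hi.kill_mem _ hm)
  have h1 : f * g' - r * u - s * v ∈ I := hi.regular _ (by
    have : X i * (f * g' - r * u - s * v) = m - f * kill i g := by
      linear_combination e - f * hg'
    rw [this]
    exact I.sub_mem hm (I.mul_mem_left _ hk))
  have h2 := hfuv g' (mem_sup_span_singleton_iff.2 ⟨f * g' - s * v,
    mem_sup_span_singleton_iff.2 ⟨_, h1, r, by ring⟩, s, by ring⟩)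
  obtain ⟨w', hw', s', e2⟩ := mem_sup_span_singleton_iff.1 h2
  obtain ⟨m', hm', r', rfl⟩ := mem_sup_span_singleton_iff.1 hw'
  refine mem_sup_span_singleton_iff.2 ⟨_, mem_sup_span_singleton_iff.2
    ⟨kill i g + X i * m', I.add_mem hk (I.mul_mem_left _ hm'), r', rfl⟩, s', ?_⟩
  linear_combination hg' + X i * e2

variable (K p q) in
/-- The ideal of the path `A.reverse, c, B`. -/
noncomputable def doublePathIdeal (c : V) (A B : List V) : Ideal (MvPolynomial σ K) :=
  pathIdeal K p q (c :: A) ⊔ pathIdeal K p q (c :: B)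

variable (K p q) in
/-- The ideal of a triangle `a, b, c` with paths attached at `a` and `b`. -/
noncomputable def triangleIdeal (c a b : V) (A B : List V) : Ideal (MvPolynomial σ K) :=
  doublePathIdeal K p q c (a :: A) (b :: B) ⊔ Ideal.span {edgeBinomial K p q a b}

variable (K p q) in
/-- The ideal generated by the variables of `c` and the paths `A` and `B`. -/
noncomputable def cutIdeal (c : V) (A B : List V) : Ideal (MvPolynomial σ K) :=
  varIdeal K [p c, q c] ⊔ pathIdeal K p q A ⊔ pathIdeal K p q B

theorem isHomogeneousIdeal_doublePathIdeal :
    IsHomogeneousIdeal (doublePathIdeal K p q c A B) :=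
  (isHomogeneousIdeal_pathIdeal K p q _).sup (isHomogeneousIdeal_pathIdeal K p q _)

theorem isHomogeneousIdeal_triangleIdeal :
    IsHomogeneousIdeal (triangleIdeal K p q c a b A B) :=
  isHomogeneousIdeal_doublePathIdeal.sup
    (isHomogeneousIdeal_span (isHomogeneous_edgeBinomial K p q a b))

theorem left_mul_edgeBinomial (a b c : V) : X (p c) * edgeBinomial K p q a b =
    X (p a) * edgeBinomial K p q c b - X (p b) * edgeBinomial K p q c a := by
  simp only [edgeBinomial]
  ring

theorem right_mul_edgeBinomial (a b c : V) : X (q c) * edgeBinomial K p q a b =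
    X (q a) * edgeBinomial K p q c b - X (q b) * edgeBinomial K p q c a := by
  simp only [edgeBinomial]
  ring

theorem edgeBinomial_mem_doublePathIdeal_left :
    edgeBinomial K p q c a ∈ doublePathIdeal K p q c (a :: A) B :=
  Ideal.mem_sup_left (Ideal.mem_sup_left (Ideal.mem_span_singleton_self _))

theorem edgeBinomial_mem_doublePathIdeal_right :
    edgeBinomial K p q c b ∈ doublePathIdeal K p q c A (b :: B) :=
  Ideal.mem_sup_right (Ideal.mem_sup_left (Ideal.mem_span_singleton_self _))

theorem left_mul_mem_doublePathIdeal :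
    X (p c) * edgeBinomial K p q a b ∈ doublePathIdeal K p q c (a :: A) (b :: B) := by
  rw [left_mul_edgeBinomial]
  exact Ideal.sub_mem _ (Ideal.mul_mem_left _ _ edgeBinomial_mem_doublePathIdeal_right)
    (Ideal.mul_mem_left _ _ edgeBinomial_mem_doublePathIdeal_left)

theorem right_mul_mem_doublePathIdeal :
    X (q c) * edgeBinomial K p q a b ∈ doublePathIdeal K p q c (a :: A) (b :: B) := by
  rw [right_mul_edgeBinomial]
  exact Ideal.sub_mem _ (Ideal.mul_mem_left _ _ edgeBinomial_mem_doublePathIdeal_right)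
    (Ideal.mul_mem_left _ _ edgeBinomial_mem_doublePathIdeal_left)

theorem pathIdeal_le_cons (a : V) (A : List V) :
    pathIdeal K p q A ≤ pathIdeal K p q (a :: A) := by
  cases A with
  | nil => exact bot_le
  | cons b A => exact le_sup_right

/-- The easy inclusion of the colon formula: x_c E_ab and y_c E_ab are combinations of E_ca and
E_cb, by expanding a 3 × 3 determinant with a repeated row. -/
theorem mul_mem_of_mem_cutIdeal {h : MvPolynomial σ K}
    (hh : h ∈ cutIdeal K p q c (a :: A) (b :: B)) :
    edgeBinomial K p q a b * h ∈ doublePathIdeal K p q c (a :: A) (b :: B) := by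
  have hle : doublePathIdeal K p q c (a :: A) (b :: B) ≤
      Submodule.comap (LinearMap.mulLeft (MvPolynomial σ K) (edgeBinomial K p q a b))
        (doublePathIdeal K p q c (a :: A) (b :: B)) := fun x hx => Ideal.mul_mem_left _ _ hx
  have : cutIdeal K p q c (a :: A) (b :: B) ≤
      Submodule.comap (LinearMap.mulLeft (MvPolynomial σ K) (edgeBinomial K p q a b))
        (doublePathIdeal K p q c (a :: A) (b :: B)) := by
    refine sup_le (sup_le (varIdeal_le_iff.2 ?_) ?_) ?_
    · intro i hi
      rw [Submodule.mem_comap, LinearMap.mulLeft_apply, mul_comm]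
      rcases List.mem_cons.1 hi with rfl | hi
      · exact left_mul_mem_doublePathIdeal
      · rw [List.mem_singleton.1 hi]
        exact right_mul_mem_doublePathIdeal
    · exact (pathIdeal_le_cons c _).trans (le_sup_left.trans hle)
    · exact (pathIdeal_le_cons c _).trans (le_sup_right.trans hle)
  exact this hh

theorem vertexFree_cutIdeal_nil (hpq : Function.Injective (Sum.elim p q)) (hcd : d ≠ c) :
    VertexFree p q (varIdeal K [p c, q c]) d := by
  refine vertexFree_varIdeal ?_ ?_
  · simpa using ⟨left_ne_left hpq hcd, left_ne_right hpq _ _⟩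
  · simpa using ⟨(left_ne_right hpq _ _).symm, right_ne_right hpq hcd⟩

theorem doublePathIdeal_le_cutIdeal :
    doublePathIdeal K p q c (a :: A) (b :: B) ≤ cutIdeal K p q c (a :: A) (b :: B) := by
  have hc : ∀ v, edgeBinomial K p q c v ∈ cutIdeal K p q c (a :: A) (b :: B) := fun v =>
    Ideal.mem_sup_left (Ideal.mem_sup_left (Ideal.sub_mem _
      (Ideal.mul_mem_right _ _ (X_mem_varIdeal (by simp)))
      (Ideal.mul_mem_left _ _ (X_mem_varIdeal (by simp)))))
  refine sup_le (sup_le ?_ ?_) (sup_le ?_ ?_)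
  · exact (Ideal.span_singleton_le_iff_mem _).2 (hc a)
  · exact le_sup_right.trans le_sup_left
  · exact (Ideal.span_singleton_le_iff_mem _).2 (hc b)
  · exact le_sup_right

/-- With c deleted, the paths from a and from b are disjoint, so the edge ab joins two components.
Its binomial is regular when b is still isolated, and attaching the path at b preserves this. -/
theorem regularMod_cutIdeal (hpq : Function.Injective (Sum.elim p q))
    (hl : (c :: a :: A ++ b :: B).Nodup) :
    RegularMod (cutIdeal K p q c (a :: A) (b :: B)) (edgeBinomial K p q a b) := by
  simp only [List.cons_append, List.nodup_cons, List.nodup_append, List.mem_cons,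
    List.mem_append, not_or] at hl
  obtain ⟨⟨hca, hcA, hcb, hcB⟩, ⟨haA, hab, haB⟩, hA, ⟨hbB, hB⟩, hAB⟩ := hl
  have hfree : ∀ v, v ≠ c → v ≠ a → v ∉ A →
      VertexFree p q (varIdeal K [p c, q c] ⊔ pathIdeal K p q (a :: A)) v := fun v h1 h2 h3 =>
    (vertexFree_cutIdeal_nil hpq h1).sup_pathIdeal hpq (by simp [h2, h3])
  have ha : RegularMod (varIdeal K [p c, q c] ⊔ pathIdeal K p q (a :: A)) (X (p a)) := by
    refine regularMod_head hpq (List.nodup_cons.2 ⟨haA, hA⟩) fun v hv =>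
      vertexFree_cutIdeal_nil hpq ?_
    rintro rfl
    rcases List.mem_cons.1 hv with h | h
    · exact hca h
    · exact hcA h
  have hb := hfree b (Ne.symm hcb) (Ne.symm hab) fun h => hAB b h b (by simp) rfl
  refine (hb.regularMod_edgeBinomial hpq hab ha).sup_pathIdeal hpq
    (List.nodup_cons.2 ⟨hbB, hB⟩) ?_ ?_
  · intro v hv
    refine (hfree v ?_ ?_ fun h => hAB v h v (by simp [hv]) rfl).sup_edgeBinomial hpq ?_ ?_
    · rintro rfl; exact hcB hv
    · rintro rfl; exact haB hv
    · rintro rfl; exact haB hv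
    · rintro rfl; exact hbB hv
  · exact hb.regularMod_left_of_pendant hpq hab fun h hh => Ideal.mul_mem_left _ _ (ha h hh)

/-- The first colon ideal. For the hard inclusion, enlarge the path ideal to the cut ideal, where
E_ab is regular. -/
theorem mul_mem_doublePathIdeal_iff (hpq : Function.Injective (Sum.elim p q))
    (hl : (c :: a :: A ++ b :: B).Nodup) (h : MvPolynomial σ K) :
    edgeBinomial K p q a b * h ∈ doublePathIdeal K p q c (a :: A) (b :: B) ↔
      h ∈ cutIdeal K p q c (a :: A) (b :: B) :=
  ⟨fun hh => regularMod_cutIdeal hpq hl h (doublePathIdeal_le_cutIdeal hh),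
    mul_mem_of_mem_cutIdeal⟩

theorem hilbertSeries_doublePathIdeal [Finite σ] (hpq : Function.Injective (Sum.elim p q))
    (hl : (c :: A ++ B).Nodup) :
    hilbertSeries (doublePathIdeal K p q c A B) =
      (1 - PowerSeries.X ^ 2) ^ (A.length + B.length) *
        hilbertSeries (⊥ : Ideal (MvPolynomial σ K)) := by
  simp only [List.cons_append, List.nodup_cons, List.nodup_append, List.mem_append, not_or] at hl
  obtain ⟨⟨hcA, hcB⟩, hA, hB, hAB⟩ := hl
  have hcA' : (c :: A).Nodup := List.nodup_cons.2 ⟨hcA, hA⟩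
  have h1 := hilbertSeries_sup_pathIdeal (K := K) hpq hcA' (fun v _ => vertexFree_bot)
    (freeMod_bot _).regular isHomogeneousIdeal_bot
  have h2 := regularMod_head (K := K) (I := ⊥) hpq hcA' fun v _ => vertexFree_bot
  have h3 : ∀ v ∈ B, VertexFree p q (⊥ ⊔ pathIdeal K p q (c :: A)) v := by
    refine fun v hv => vertexFree_bot.sup_pathIdeal hpq ?_
    rw [List.mem_cons, not_or]
    constructor
    · rintro rfl; exact hcB hv
    · exact fun h => hAB v h v hv rfl
  rw [bot_sup_eq] at h1 h2 h3
  rw [doublePathIdeal, hilbertSeries_sup_pathIdeal hpq (List.nodup_cons.2 ⟨hcB, hB⟩) h3 h2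
    (isHomogeneousIdeal_pathIdeal K p q _), h1]
  ring

theorem hilbertSeries_cutIdeal [Finite σ] (hpq : Function.Injective (Sum.elim p q))
    (hl : (c :: a :: A ++ b :: B).Nodup) :
    hilbertSeries (cutIdeal K p q c (a :: A) (b :: B)) =
      (1 - PowerSeries.X) ^ 2 * (1 - PowerSeries.X ^ 2) ^ (A.length + B.length) *
        hilbertSeries (⊥ : Ideal (MvPolynomial σ K)) := by
  simp only [List.cons_append, List.nodup_cons, List.nodup_append, List.mem_cons,
    List.mem_append, not_or] at hl
  obtain ⟨⟨hca, hcA, hcb, hcB⟩, ⟨haA, hab, haB⟩, hA, ⟨hbB, hB⟩, hAB⟩ := hl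
  have hc : [p c, q c].Nodup := by simpa using left_ne_right hpq c c
  have hfree : ∀ v, v ≠ c → v ≠ a → v ∉ A →
      VertexFree p q (varIdeal K [p c, q c] ⊔ pathIdeal K p q (a :: A)) v := fun v h1 h2 h3 =>
    (vertexFree_cutIdeal_nil hpq h1).sup_pathIdeal hpq (by simp [h2, h3])
  rw [cutIdeal, hilbertSeries_sup_pathIdeal hpq (List.nodup_cons.2 ⟨hbB, hB⟩) ?_ ?_
      ((isHomogeneousIdeal_varIdeal _).sup (isHomogeneousIdeal_pathIdeal K p q _)),
    hilbertSeries_sup_pathIdeal hpq (List.nodup_cons.2 ⟨haA, hA⟩) ?_ ?_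
      (isHomogeneousIdeal_varIdeal _), hilbertSeries_varIdeal hc]
  · simp only [List.length_cons, List.length_nil]
    ring
  · refine fun v hv => vertexFree_cutIdeal_nil hpq ?_
    rintro rfl; exact hcA hv
  · exact (vertexFree_cutIdeal_nil hpq (Ne.symm hca)).1.regular
  · refine fun v hv => hfree v ?_ ?_ fun h => hAB v h v (by simp [hv]) rfl
    · rintro rfl; exact hcB hv
    · rintro rfl; exact haB hv
  · exact (hfree b (Ne.symm hcb) (Ne.symm hab) fun h => hAB b h b (by simp) rfl).1.regular

/-- After factoring out (1 - t)^2, the path contributes (1 + t)^2 and the colon ideal t^2. -/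
theorem hilbertSeries_triangleIdeal [Finite σ] (hpq : Function.Injective (Sum.elim p q))
    (hl : (c :: a :: A ++ b :: B).Nodup) :
    hilbertSeries (triangleIdeal K p q c a b A B) =
      (1 - PowerSeries.X) ^ 2 * (1 + 2 * PowerSeries.X) *
        (1 - PowerSeries.X ^ 2) ^ (A.length + B.length) *
        hilbertSeries (⊥ : Ideal (MvPolynomial σ K)) := by
  rw [triangleIdeal, hilbertSeries_sup_span isHomogeneousIdeal_doublePathIdeal
    (isHomogeneous_edgeBinomial K p q a b) (mul_mem_doublePathIdeal_iff hpq hl),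
    hilbertSeries_doublePathIdeal hpq hl, hilbertSeries_cutIdeal hpq hl]
  simp only [List.length_cons]
  ring

end Spider

/-! ### Regularity of x_c modulo the triangle ideal; nets and spiders -/

section Spider

variable {V σ K : Type*} [Field K] {p q : V → σ} {a b c d : V} {A B D : List V}

/-- In a triangle `a, b, c` with a path attached at `a`, the variable `x_c` is regular. -/
theorem regularMod_left_triangle_aux (hpq : Function.Injective (Sum.elim p q))
    (hl : (c :: b :: a :: A).Nodup) :
    RegularMod (pathIdeal K p q (c :: b :: a :: A) ⊔ Ideal.span {edgeBinomial K p q a c})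
      (X (p c)) := by
  have hI := regularMod_head (K := K) (I := ⊥) hpq hl fun v _ => vertexFree_bot
  rw [bot_sup_eq] at hI
  have hl' := hl
  simp only [List.nodup_cons, List.mem_cons, not_or] at hl'
  obtain ⟨⟨hcb, hca, hcA⟩, ⟨hba, hbA⟩, haA, hA⟩ := hl'
  refine hI.sup_span_of_colon fun h hh => ?_
  have hvar : varIdeal K [p c, p b, q b] = varIdeal K [p b, q b] ⊔ Ideal.span {X (p c)} := rfl
  -- Adding x_b and y_b kills both edges at b. In this larger ideal E_ac is congruent to x_a y_c, a
  -- product of regular elements.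
  have hM : pathIdeal K p q (c :: b :: a :: A) ⊔ Ideal.span {X (p c)} ≤
      varIdeal K [p c, p b, q b] ⊔ pathIdeal K p q (a :: A) := by
    have hb : ∀ v, edgeBinomial K p q b v ∈ varIdeal K [p c, p b, q b] := fun v =>
      Ideal.sub_mem _ (Ideal.mul_mem_right _ _ (X_mem_varIdeal (by simp)))
        (Ideal.mul_mem_left _ _ (X_mem_varIdeal (by simp)))
    rw [pathIdeal, pathIdeal, ← span_edgeBinomial_comm]
    refine sup_le (sup_le ?_ (sup_le ?_ le_sup_right)) ?_
    · exact (Ideal.span_singleton_le_iff_mem _).2 (Ideal.mem_sup_left (hb c))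
    · exact (Ideal.span_singleton_le_iff_mem _).2 (Ideal.mem_sup_left (hb a))
    · exact (Ideal.span_singleton_le_iff_mem _).2 (Ideal.mem_sup_left (X_mem_varIdeal (by simp)))
  have hfree : ∀ v, v ≠ c → v ≠ b → VertexFree p q (varIdeal K [p c, p b, q b]) v := by
    intro v h1 h2
    refine vertexFree_varIdeal ?_ ?_
    · simpa using ⟨left_ne_left hpq h1, left_ne_left hpq h2, left_ne_right hpq _ _⟩
    · simpa using ⟨(left_ne_right hpq _ _).symm, (left_ne_right hpq _ _).symm,
        right_ne_right hpq h2⟩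
  have ha : RegularMod (varIdeal K [p c, p b, q b] ⊔ pathIdeal K p q (a :: A)) (X (p a)) := by
    refine regularMod_head hpq (List.nodup_cons.2 ⟨haA, hA⟩) fun v hv => hfree v ?_ ?_
    · rintro rfl
      rcases List.mem_cons.1 hv with h | h
      · exact hca h
      · exact hcA h
    · rintro rfl
      rcases List.mem_cons.1 hv with h | h
      · exact hba h
      · exact hbA h
  have hqc : ∀ l : List V, c ∉ l →
      FreeMod (varIdeal K [p c, p b, q b] ⊔ pathIdeal K p q l) (q c) := by
    intro l hcl
    refine FreeMod.sup_pathIdeal_right hpq (freeMod_varIdeal ?_) hcl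
    simpa using ⟨(left_ne_right hpq _ _).symm, (left_ne_right hpq _ _).symm,
      right_ne_right hpq hcb⟩
  have hE : RegularMod (varIdeal K [p c, p b, q b] ⊔ pathIdeal K p q (a :: A))
      (edgeBinomial K p q a c) := by
    refine (ha.mul (hqc (a :: A) (by simp [hca, hcA])).regular).congr ?_
    have : X (p a) * X (q c) - edgeBinomial K p q a c = X (q a) * X (p c) := by
      rw [edgeBinomial]; ring
    rw [this]
    exact Ideal.mul_mem_left _ _ (Ideal.mem_sup_left (X_mem_varIdeal (by simp)))
  have hh' := hE h (hM hh)
  rw [hvar, sup_right_comm] at hh'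
  obtain ⟨h', hmem, k, rfl⟩ := mem_sup_span_singleton_iff.1 hh'
  refine ⟨h', ?_, k, rfl⟩
  -- After splitting off the multiple of x_c, the remainder lies in the cut ideal at b of the path
  -- c, b, a, A, which E_ac multiplies into the path ideal.
  have hcut : h' ∈ cutIdeal K p q b (a :: A) [c] := Ideal.mem_sup_left hmem
  have := mul_mem_of_mem_cutIdeal hcut
  have e : doublePathIdeal K p q b (a :: A) [c] = pathIdeal K p q (c :: b :: a :: A) := by
    simp only [doublePathIdeal, pathIdeal, span_edgeBinomial_comm K p q c b]
    simp only [bot_le, sup_of_le_left]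
    ac_rfl
  rwa [e] at this

theorem triangleIdeal_eq : triangleIdeal K p q c a b A B =
    pathIdeal K p q (c :: b :: a :: A) ⊔ Ideal.span {edgeBinomial K p q a c} ⊔
      pathIdeal K p q (b :: B) := by
  simp only [triangleIdeal, doublePathIdeal, pathIdeal, span_edgeBinomial_comm K p q c a,
    span_edgeBinomial_comm K p q a b]
  ac_rfl

/-- In a triangle `a, b, c` with a path attached at `a`, the variable `y_b` is regular
modulo `x_c`. -/
theorem regularMod_right_triangle_aux (hpq : Function.Injective (Sum.elim p q))
    (hl : (c :: b :: a :: A).Nodup) :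
    RegularMod (pathIdeal K p q (c :: b :: a :: A) ⊔ Ideal.span {edgeBinomial K p q a c} ⊔
      Ideal.span {X (p c)}) (X (q b)) := by
  simp only [List.nodup_cons, List.mem_cons, not_or] at hl
  obtain ⟨⟨hcb, hca, hcA⟩, ⟨hba, hbA⟩, haA, hA⟩ := hl
  have hba' : (b :: a :: A).Nodup := by
    simp only [List.nodup_cons, List.mem_cons, not_or]
    exact ⟨⟨hba, hbA⟩, haA, hA⟩
  have hv : varIdeal K [p c] = Ideal.span {X (p c)} := by simp [varIdeal]
  set P := varIdeal K [p c] ⊔ pathIdeal K p q (b :: a :: A) with hP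
  have hcP : (X (p c) : MvPolynomial σ K) ∈ P :=
    Ideal.mem_sup_left (X_mem_varIdeal (List.mem_singleton_self _))
  have hfree : ∀ v, v ≠ c → VertexFree p q (varIdeal K [p c]) v := fun v h =>
    vertexFree_varIdeal (by simpa using left_ne_left hpq h)
      (by simpa using (left_ne_right hpq _ _).symm)
  have hmem : ∀ v ∈ b :: a :: A, v ≠ c := by
    intro v hv
    exact ne_of_mem_of_not_mem hv (by simp [hcb, hca, hcA])
  have hPb : RegularMod P (X (q b)) := by
    rw [hP, ← pathIdeal_swap]
    exact regularMod_head (injective_sum_elim_swap hpq) hba' fun v hv => (hfree v (hmem v hv)).swap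
  have hPc : FreeMod P (q c) := by
    have h0 : FreeMod (varIdeal K [p c]) (q c) :=
      freeMod_varIdeal (by simpa using (left_ne_right hpq _ _).symm)
    exact h0.sup_pathIdeal_right hpq (by simp only [List.mem_cons]; tauto)
  -- Modulo x_c the two edges at c become, up to sign, y_c x_b and y_c x_a, with y_c free modulo the
  -- rest.
  have e : pathIdeal K p q (c :: b :: a :: A) ⊔ Ideal.span {edgeBinomial K p q a c} ⊔
      Ideal.span {X (p c)} =
      P ⊔ Ideal.span {X (q c) * X (p b)} ⊔ Ideal.span {X (q c) * X (p a)} := by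
    have h1 : P ⊔ Ideal.span {edgeBinomial K p q c b} =
        P ⊔ Ideal.span {X (q c) * X (p b)} := by
      refine sup_span_congr_of_add_mem ?_
      have : edgeBinomial K p q c b + X (q c) * X (p b) = X (p c) * X (q b) := by
        rw [edgeBinomial]; ring
      rw [this]
      exact Ideal.mul_mem_right _ _ hcP
    have h2 : P ⊔ Ideal.span {edgeBinomial K p q c a} =
        P ⊔ Ideal.span {X (q c) * X (p a)} := by
      refine sup_span_congr_of_add_mem ?_
      have : edgeBinomial K p q c a + X (q c) * X (p a) = X (p c) * X (q a) := by
        rw [edgeBinomial]; ring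
      rw [this]
      exact Ideal.mul_mem_right _ _ hcP
    rw [← h1, sup_right_comm P, ← h2, hP, hv, pathIdeal, span_edgeBinomial_comm K p q c a]
    ac_rfl
  rw [e]
  refine hPc.regularMod_sup_mul (kill_X_of_ne (right_ne_right hpq (Ne.symm hcb))) hPb ?_
  -- Modulo x_a and x_b the edge ab disappears, so y_b occurs in no generator.
  have e2 : P ⊔ Ideal.span {X (p b)} ⊔ Ideal.span {X (p a)} =
      varIdeal K [p c, p b, p a] ⊔ pathIdeal K p q (a :: A) := by
    have h1 : edgeBinomial K p q b a ∈ Ideal.span {X (p b)} ⊔ Ideal.span {X (p a)} :=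
      Ideal.sub_mem _
        (Ideal.mul_mem_right _ _ (Ideal.mem_sup_left (Ideal.mem_span_singleton_self _)))
        (Ideal.mul_mem_right _ _ (Ideal.mem_sup_right (Ideal.mem_span_singleton_self _)))
    have h2 : Ideal.span {edgeBinomial K p q b a} ⊔
        (Ideal.span {X (p b)} ⊔ Ideal.span {X (p a)}) =
        Ideal.span {X (p b)} ⊔ Ideal.span {X (p a)} :=
      sup_eq_right.2 ((Ideal.span_singleton_le_iff_mem _).2 h1)
    rw [hP, pathIdeal, sup_assoc, sup_comm (Ideal.span {edgeBinomial K p q b a}), sup_assoc,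
      sup_assoc, h2]
    simp only [varIdeal, bot_sup_eq]
    ac_rfl
  rw [e2]
  refine (FreeMod.sup_pathIdeal_right hpq (freeMod_varIdeal ?_) ?_).regular
  · simpa using ⟨(left_ne_right hpq _ _).symm, (left_ne_right hpq _ _).symm,
      (left_ne_right hpq _ _).symm⟩
  · simp [hba, hbA]

/-- In a triangle `a, b, c` with paths attached at `a` and `b`, the variable `x_c` is regular. -/
theorem regularMod_left_triangleIdeal (hpq : Function.Injective (Sum.elim p q))
    (hl : (c :: a :: A ++ b :: B).Nodup) :
    RegularMod (triangleIdeal K p q c a b A B) (X (p c)) := by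
  simp only [List.cons_append, List.nodup_cons, List.nodup_append, List.mem_cons,
    List.mem_append, not_or] at hl
  obtain ⟨⟨hca, hcA, hcb, hcB⟩, ⟨haA, hab, haB⟩, hA, ⟨hbB, hB⟩, hAB⟩ := hl
  have hl' : (c :: b :: a :: A).Nodup := by
    simp only [List.nodup_cons, List.mem_cons, not_or]
    exact ⟨⟨hcb, hca, hcA⟩, ⟨Ne.symm hab, fun h => hAB b h b (by simp) rfl⟩, haA, hA⟩
  -- The roles of x and y are exchanged to attach the path at b: modulo x_c the product y_c x_b
  -- vanishes, so y_b, not x_b, is the variable to use.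
  rw [triangleIdeal_eq, ← pathIdeal_swap K p q (b :: B)]
  refine (regularMod_left_triangle_aux hpq hl').sup_pathIdeal (injective_sum_elim_swap hpq)
    (List.nodup_cons.2 ⟨hbB, hB⟩) ?_ (regularMod_right_triangle_aux hpq hl')
  intro v hv
  have hvc : v ≠ c := by rintro rfl; exact hcB hv
  have hva : v ≠ a := by rintro rfl; exact haB hv
  have hvb : v ≠ b := by rintro rfl; exact hbB hv
  have hvA : v ∉ A := fun h => hAB v h v (by simp [hv]) rfl
  have h0 : VertexFree p q (⊥ ⊔ pathIdeal K p q (c :: b :: a :: A)) v :=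
    vertexFree_bot.sup_pathIdeal hpq (by simp [hva, hvb, hvc, hvA])
  rw [bot_sup_eq] at h0
  have h1 := h0.sup_edgeBinomial hpq (Ne.symm hva) (Ne.symm hvc)
  exact ⟨h1.2.sup_X (left_ne_right hpq _ _), h1.1.sup_X (left_ne_left hpq (Ne.symm hvc))⟩

variable (K p q) in
/-- The ideal of a triangle `a, b, c` with paths attached at all three vertices. -/
noncomputable def netIdeal (c a b : V) (A B D : List V) : Ideal (MvPolynomial σ K) :=
  triangleIdeal K p q c a b A B ⊔ pathIdeal K p q (c :: D)

variable (K p q) in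
/-- The ideal of three paths attached at a common vertex `c`. -/
noncomputable def spiderIdeal (c d : V) (A B D : List V) : Ideal (MvPolynomial σ K) :=
  doublePathIdeal K p q c A B ⊔ Ideal.span {edgeBinomial K p q c d} ⊔ pathIdeal K p q (d :: D)

theorem vertexFree_doublePathIdeal (hpq : Function.Injective (Sum.elim p q))
    (hd : d ∉ c :: A ++ B) : VertexFree p q (doublePathIdeal K p q c A B) d := by
  simp only [List.cons_append, List.mem_cons, List.mem_append, not_or] at hd
  have h0 : VertexFree p q (⊥ ⊔ pathIdeal K p q (c :: A)) d :=
    vertexFree_bot.sup_pathIdeal hpq (by simp [hd])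
  rw [bot_sup_eq] at h0
  exact h0.sup_pathIdeal hpq (by simp [hd])

theorem vertexFree_triangleIdeal (hpq : Function.Injective (Sum.elim p q))
    (hd : d ∉ c :: a :: A ++ b :: B) : VertexFree p q (triangleIdeal K p q c a b A B) d := by
  refine (vertexFree_doublePathIdeal hpq hd).sup_edgeBinomial hpq ?_ ?_ <;>
  · rintro rfl
    simp at hd

theorem hilbertSeries_netIdeal [Finite σ] (hpq : Function.Injective (Sum.elim p q))
    (hl : (c :: a :: A ++ b :: B ++ D).Nodup) :
    hilbertSeries (netIdeal K p q c a b A B D) =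
      (1 - PowerSeries.X) ^ 2 * (1 + 2 * PowerSeries.X) *
        (1 - PowerSeries.X ^ 2) ^ (A.length + B.length + D.length) *
        hilbertSeries (⊥ : Ideal (MvPolynomial σ K)) := by
  obtain ⟨hl1, hD, hdis⟩ := List.nodup_append.1 hl
  rw [netIdeal, hilbertSeries_sup_pathIdeal hpq ?_ ?_ (regularMod_left_triangleIdeal hpq hl1)
    isHomogeneousIdeal_triangleIdeal, hilbertSeries_triangleIdeal hpq hl1]
  · ring
  · exact List.nodup_cons.2 ⟨fun h => hdis c (by simp) c h rfl, hD⟩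
  · exact fun v hv => vertexFree_triangleIdeal hpq fun h => hdis v h v hv rfl

/-- The edge cd is the only one of the third leg whose binomial is treated as a zero divisor; its
colon ideal is the triangle ideal. The rest of the leg is attached at d by regular steps. -/
theorem hilbertSeries_spiderIdeal [Finite σ] (hpq : Function.Injective (Sum.elim p q))
    (hl : (c :: a :: A ++ b :: B ++ d :: D).Nodup) :
    hilbertSeries (spiderIdeal K p q c d (a :: A) (b :: B) D) =
      (1 - PowerSeries.X) ^ 2 * (1 + 2 * PowerSeries.X - 2 * PowerSeries.X ^ 3) *
        (1 - PowerSeries.X ^ 2) ^ (A.length + B.length + D.length) *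
        hilbertSeries (⊥ : Ideal (MvPolynomial σ K)) := by
  obtain ⟨hl1, hD, hdis⟩ := List.nodup_append.1 hl
  have hdfree : ∀ v ∈ d :: D, v ∉ c :: a :: A ++ b :: B := fun v hv h => hdis v h v hv rfl
  have hdc : c ≠ d := hdis c (by simp) d (by simp)
  have hxc := regularMod_left_triangleIdeal (K := K) hpq hl1
  have hle : ∀ f ∈ doublePathIdeal K p q c (a :: A) (b :: B),
      f ∈ triangleIdeal K p q c a b A B := fun f hf => Ideal.mem_sup_left hf
  have hmul : ∀ f, f * edgeBinomial K p q a b ∈ doublePathIdeal K p q c (a :: A) (b :: B) →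
      ∀ h ∈ triangleIdeal K p q c a b A B,
        f * h ∈ doublePathIdeal K p q c (a :: A) (b :: B) := by
    intro f hf h hh
    obtain ⟨i, hi, g, rfl⟩ := mem_sup_span_singleton_iff.1 hh
    have : f * (i + g * edgeBinomial K p q a b) = f * i + g * (f * edgeBinomial K p q a b) := by
      ring
    rw [this]
    exact Ideal.add_mem _ (Ideal.mul_mem_left _ _ hi) (Ideal.mul_mem_left _ _ hf)
  have hE : edgeBinomial K p q c d * edgeBinomial K p q a b ∈
      doublePathIdeal K p q c (a :: A) (b :: B) := by
    have : edgeBinomial K p q c d * edgeBinomial K p q a b =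
        X (q d) * (X (p c) * edgeBinomial K p q a b) -
          X (p d) * (X (q c) * edgeBinomial K p q a b) := by
      rw [edgeBinomial]; ring
    rw [this]
    exact Ideal.sub_mem _ (Ideal.mul_mem_left _ _ left_mul_mem_doublePathIdeal)
      (Ideal.mul_mem_left _ _ right_mul_mem_doublePathIdeal)
  -- Forwards, E_cd is regular modulo the triangle ideal, because x_c is. Backwards, E_cd E_ab is a
  -- combination of x_c E_ab and y_c E_ab.
  have hcolon : ∀ h, edgeBinomial K p q c d * h ∈ doublePathIdeal K p q c (a :: A) (b :: B) ↔
      h ∈ triangleIdeal K p q c a b A B := fun h =>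
    ⟨fun hh => (vertexFree_triangleIdeal hpq (hdfree d (by simp))).regularMod_edgeBinomial hpq
      hdc hxc h (hle _ hh), hmul _ hE h⟩
  -- Regularity of x_c modulo the path ideal is not needed: x_c h ∈ I puts h in the triangle ideal,
  -- which y_c multiplies into I.
  have hpend := (vertexFree_doublePathIdeal (K := K) hpq
    (hdfree d (by simp))).regularMod_left_of_pendant hpq hdc
    fun h hh => hmul _ right_mul_mem_doublePathIdeal h (hxc h (hle _ hh))
  have hEh := isHomogeneous_edgeBinomial K p q c d
  rw [spiderIdeal, hilbertSeries_sup_pathIdeal hpq hD ?_ hpend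
      (isHomogeneousIdeal_doublePathIdeal.sup (isHomogeneousIdeal_span hEh)),
    hilbertSeries_sup_span isHomogeneousIdeal_doublePathIdeal hEh hcolon,
    hilbertSeries_doublePathIdeal hpq hl1, hilbertSeries_triangleIdeal hpq hl1]
  · simp only [List.length_cons]
    ring
  · intro v hv
    have hv' := hdfree v (List.mem_cons_of_mem _ hv)
    refine (vertexFree_doublePathIdeal hpq hv').sup_edgeBinomial hpq ?_ ?_
    · rintro rfl
      simp at hv'
    · rintro rfl
      exact (List.nodup_cons.1 hD).1 hv

end Spider

/-! ### From graphs to list ideals -/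

section Translation

variable {V : Type*} {K : Type*} [Field K]

theorem pathIdeal_ofFn_le_iff {m : ℕ} (a : Fin m → V) (J : Ideal (EdgeRing V K)) :
    pathIdeal K Sum.inl Sum.inr (List.ofFn a) ≤ J ↔
      ∀ i j, s(i, j) ∈ pathEdges a → edgeBinomial K Sum.inl Sum.inr i j ∈ J := by
  rw [pathIdeal_le_iff]
  constructor
  · rintro h i j ⟨k, hk, e⟩
    have hk' := h k (by simpa using hk)
    simp only [List.getElem_ofFn] at hk'
    rcases Sym2.eq_iff.1 e with ⟨rfl, rfl⟩ | ⟨rfl, rfl⟩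
    · exact hk'
    · rw [edgeBinomial_comm]
      exact J.neg_mem hk'
  · intro h k hk
    simp only [List.getElem_ofFn]
    exact h _ _ ⟨k, by simpa using hk, rfl⟩

theorem edgeBinomial_mem_iff (a b : V) (J : Ideal (EdgeRing V K)) :
    edgeBinomial K Sum.inl Sum.inr a b ∈ J ↔
      ∀ i j, s(i, j) = s(a, b) → edgeBinomial K Sum.inl Sum.inr i j ∈ J := by
  constructor
  · intro h i j e
    rcases Sym2.eq_iff.1 e with ⟨rfl, rfl⟩ | ⟨rfl, rfl⟩
    · exact h
    · rw [edgeBinomial_comm]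
      exact J.neg_mem h
  · exact fun h => h a b rfl

theorem SimpleGraph.binomialEdgeIdeal_le_iff [LinearOrder V] (G : SimpleGraph V)
    (J : Ideal (EdgeRing V K)) :
    G.binomialEdgeIdeal K ≤ J ↔
      ∀ i j, s(i, j) ∈ G.edgeSet → edgeBinomial K Sum.inl Sum.inr i j ∈ J := by
  rw [SimpleGraph.binomialEdgeIdeal, Ideal.span_le]
  constructor
  · intro h i j hij
    rw [SimpleGraph.mem_edgeSet] at hij
    rcases lt_or_gt_of_ne hij.ne with hlt | hlt
    · exact h ⟨i, j, hlt, hij, rfl⟩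
    · rw [edgeBinomial_comm]
      exact J.neg_mem (h ⟨j, i, hlt, hij.symm, rfl⟩)
  · rintro h _ ⟨i, j, -, hij, rfl⟩
    exact h i j hij

theorem pathIdeal_cons_le_iff (c a : V) (A : List V) (J : Ideal (EdgeRing V K)) :
    pathIdeal K Sum.inl Sum.inr (c :: a :: A) ≤ J ↔
      edgeBinomial K Sum.inl Sum.inr c a ∈ J ∧ pathIdeal K Sum.inl Sum.inr (a :: A) ≤ J := by
  rw [pathIdeal, sup_le_iff, Ideal.span_singleton_le_iff_mem]

theorem nodup_ofFn_append {r s t : ℕ} {u : Fin r → V} {v : Fin s → V} {w : Fin t → V}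
    (h : Function.Injective (Sum.elim u (Sum.elim v w))) :
    (List.ofFn u ++ (List.ofFn v ++ List.ofFn w)).Nodup := by
  rw [Sum.elim_injective] at h
  obtain ⟨hu, hvw, huvw⟩ := h
  rw [Sum.elim_injective] at hvw
  obtain ⟨hv, hw, hvw⟩ := hvw
  simp only [List.nodup_append, List.nodup_ofFn, List.mem_append, List.mem_ofFn]
  refine ⟨hu, ⟨hv, hw, ?_⟩, ?_⟩
  · rintro _ ⟨i, rfl⟩ _ ⟨j, rfl⟩
    exact hvw i j
  · rintro _ ⟨i, rfl⟩ _ (⟨j, rfl⟩ | ⟨j, rfl⟩)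
    · exact huvw i (.inl j)
    · exact huvw i (.inr j)

theorem card_eq_of_bijective {n r s t : ℕ} {u : Fin r → Fin n} {v : Fin s → Fin n}
    {w : Fin t → Fin n} (h : Function.Bijective (Sum.elim u (Sum.elim v w))) :
    n = r + (s + t) := by
  simpa using (Fintype.card_of_bijective h).symm

/-- Since 1 - t^2 = (1 - t)(1 + t), the numerator contains (1 - t)^(2 + m), which leaves exponent e
= N - 2 - m in the denominator. -/
theorem eq_inv_mul_of_mul_eq_one {P H₀ : PowerSeries ℚ} {m e N : ℕ}
    (hH₀ : (1 - PowerSeries.X) ^ N * H₀ = 1) (hN : N = 2 + m + e) :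
    (1 - PowerSeries.X) ^ 2 * P * (1 - PowerSeries.X ^ 2) ^ m * H₀ =
      ((1 - PowerSeries.X) ^ e)⁻¹ * P * (1 + PowerSeries.X) ^ m := by
  have h0 : PowerSeries.constantCoeff ((1 - PowerSeries.X : PowerSeries ℚ) ^ e) ≠ 0 := by simp
  have h1 : (1 - PowerSeries.X ^ 2 : PowerSeries ℚ) =
      (1 - PowerSeries.X) * (1 + PowerSeries.X) := by ring
  rw [mul_assoc (_⁻¹), mul_comm (_⁻¹), PowerSeries.eq_mul_inv_iff_mul_eq h0, h1, mul_pow]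
  calc _ = (P * (1 + PowerSeries.X) ^ m) * ((1 - PowerSeries.X) ^ (2 + m + e) * H₀) := by ring
    _ = _ := by rw [← hN, hH₀, mul_one]

theorem SimpleGraph.IsT3.hilbertSeries_binomialEdgeIdeal {n : ℕ} {G : SimpleGraph (Fin n)}
    (h : G.IsT3) : hilbertSeries (G.binomialEdgeIdeal K) =
      ((1 - PowerSeries.X) ^ (n + 2))⁻¹ *
        (1 + 2 * PowerSeries.X - 2 * PowerSeries.X ^ 3) * (1 + PowerSeries.X) ^ (n - 4) := by
  obtain ⟨r, s, t, hr, hs, ht, u, v, w, hbij, hE⟩ := h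
  obtain ⟨r, rfl⟩ := Nat.exists_eq_add_of_le' hr
  obtain ⟨s, rfl⟩ := Nat.exists_eq_add_of_le' hs
  obtain ⟨t, rfl⟩ := Nat.exists_eq_add_of_le' ht
  replace hE : G.edgeSet = pathEdges u ∪ pathEdges v ∪ pathEdges w ∪
      {s(u 0, v 0), s(u 0, w 0)} := hE
  have hn := card_eq_of_bijective hbij
  have hu : List.ofFn u = u 0 :: u 1 :: List.ofFn fun i : Fin r => u i.succ.succ := by
    rw [List.ofFn_succ, List.ofFn_succ]; rfl
  have hv : List.ofFn v = v 0 :: List.ofFn fun i : Fin s => v i.succ := List.ofFn_succ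
  have hw : List.ofFn w = w 0 :: List.ofFn fun i : Fin t => w i.succ := List.ofFn_succ
  have hnd := nodup_ofFn_append hbij.1
  have key : G.binomialEdgeIdeal K = spiderIdeal K Sum.inl Sum.inr (u 0) (u 1)
      (List.ofFn v) (List.ofFn w) (List.ofFn fun i : Fin r => u i.succ.succ) := by
    -- Two ideals are equal when the same ideals J contain them, so only membership of the edge
    -- binomials in J has to be matched.
    refine eq_of_forall_ge_iff fun J => ?_
    have h1 := pathIdeal_ofFn_le_iff u J
    have h2 := pathIdeal_ofFn_le_iff v J
    have h3 := pathIdeal_ofFn_le_iff w J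
    have h4 := edgeBinomial_mem_iff (u 0) (v 0) J
    have h5 := edgeBinomial_mem_iff (u 0) (w 0) J
    rw [hu, pathIdeal_cons_le_iff] at h1
    rw [hv] at h2 ⊢
    rw [hw] at h3 ⊢
    rw [SimpleGraph.binomialEdgeIdeal_le_iff, hE, spiderIdeal, doublePathIdeal]
    simp only [sup_le_iff, pathIdeal_cons_le_iff, Ideal.span_singleton_le_iff_mem,
      Set.mem_union, Set.mem_insert_iff, Set.mem_singleton_iff, or_imp, forall_and]
    rw [← h1, ← h2, ← h3, ← h4, ← h5]
    exact ⟨fun ⟨⟨⟨⟨x1, x2⟩, x3⟩, x4⟩, x5, x6⟩ => ⟨⟨⟨⟨x5, x3⟩, x6, x4⟩, x1⟩, x2⟩,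
      fun ⟨⟨⟨⟨x5, x3⟩, x6, x4⟩, x1⟩, x2⟩ => ⟨⟨⟨⟨x1, x2⟩, x3⟩, x4⟩, x5, x6⟩⟩
  rw [hu, hv, hw] at hnd
  rw [key, hv, hw, hilbertSeries_spiderIdeal (by simpa using Function.injective_id) ?_]
  · simp only [List.length_ofFn]
    -- Four vertices are outside the counted tails: the centre and its three neighbours.
    have hm : n - 4 = s + t + r := by omega
    rw [hm]
    refine eq_inv_mul_of_mul_eq_one (N := n + n) ?_ (by omega)
    simpa using hilbertSeries_bot_mul (σ := Fin n ⊕ Fin n) (K := K)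
  · refine (List.Perm.nodup_iff ?_).1 hnd
    exact (List.perm_append_comm).cons _

theorem SimpleGraph.IsG3.hilbertSeries_binomialEdgeIdeal {n : ℕ} {G : SimpleGraph (Fin n)}
    (h : G.IsG3) : hilbertSeries (G.binomialEdgeIdeal K) =
      ((1 - PowerSeries.X) ^ (n + 1))⁻¹ *
        (1 + 2 * PowerSeries.X) * (1 + PowerSeries.X) ^ (n - 3) := by
  obtain ⟨r, s, t, hr, hs, ht, u, v, w, hbij, hE⟩ := h
  obtain ⟨r, rfl⟩ := Nat.exists_eq_add_of_le' hr
  obtain ⟨s, rfl⟩ := Nat.exists_eq_add_of_le' hs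
  obtain ⟨t, rfl⟩ := Nat.exists_eq_add_of_le' ht
  replace hE : G.edgeSet = pathEdges u ∪ pathEdges v ∪ pathEdges w ∪
      {s(u 0, v 0), s(u 0, w 0), s(v 0, w 0)} := hE
  have hn := card_eq_of_bijective hbij
  have hu : List.ofFn u = u 0 :: List.ofFn fun i : Fin r => u i.succ := List.ofFn_succ
  have hv : List.ofFn v = v 0 :: List.ofFn fun i : Fin s => v i.succ := List.ofFn_succ
  have hw : List.ofFn w = w 0 :: List.ofFn fun i : Fin t => w i.succ := List.ofFn_succ
  have hnd := nodup_ofFn_append hbij.1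
  have key : G.binomialEdgeIdeal K = netIdeal K Sum.inl Sum.inr (u 0) (v 0) (w 0)
      (List.ofFn fun i : Fin s => v i.succ) (List.ofFn fun i : Fin t => w i.succ)
      (List.ofFn fun i : Fin r => u i.succ) := by
    refine eq_of_forall_ge_iff fun J => ?_
    have h1 := pathIdeal_ofFn_le_iff u J
    have h2 := pathIdeal_ofFn_le_iff v J
    have h3 := pathIdeal_ofFn_le_iff w J
    have h4 := edgeBinomial_mem_iff (u 0) (v 0) J
    have h5 := edgeBinomial_mem_iff (u 0) (w 0) J
    have h6 := edgeBinomial_mem_iff (v 0) (w 0) J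
    rw [hu] at h1
    rw [hv] at h2
    rw [hw] at h3
    rw [SimpleGraph.binomialEdgeIdeal_le_iff, hE, netIdeal, triangleIdeal, doublePathIdeal]
    simp only [sup_le_iff, pathIdeal_cons_le_iff, Ideal.span_singleton_le_iff_mem,
      Set.mem_union, Set.mem_insert_iff, Set.mem_singleton_iff, or_imp, forall_and]
    rw [← h1, ← h2, ← h3, ← h4, ← h5, ← h6]
    exact ⟨fun ⟨⟨⟨x1, x2⟩, x3⟩, x4, x5, x6⟩ => ⟨⟨⟨⟨x4, x2⟩, x5, x3⟩, x6⟩, x1⟩,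
      fun ⟨⟨⟨⟨x4, x2⟩, x5, x3⟩, x6⟩, x1⟩ => ⟨⟨⟨x1, x2⟩, x3⟩, x4, x5, x6⟩⟩
  rw [hu, hv, hw] at hnd
  rw [key, hilbertSeries_netIdeal (by simpa using Function.injective_id) ?_]
  · simp only [List.length_ofFn]
    -- Here only the three triangle vertices are outside the tails.
    have hm : n - 3 = s + t + r := by omega
    rw [hm]
    refine eq_inv_mul_of_mul_eq_one (N := n + n) ?_ (by omega)
    simpa using hilbertSeries_bot_mul (σ := Fin n ⊕ Fin n) (K := K)
  · refine (List.Perm.nodup_iff ?_).1 hnd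
    exact (List.perm_append_comm).cons _

end Translation

theorem lemma4p11 (K : Type*) [Field K] (n : ℕ) (G : SimpleGraph (Fin n)) :
    (G.IsT3 → 3 < n →
      hilbertSeries (G.binomialEdgeIdeal K) =
        ((1 - PowerSeries.X) ^ (n + 2))⁻¹ *
          (1 + 2 * PowerSeries.X - 2 * PowerSeries.X ^ 3) * (1 + PowerSeries.X) ^ (n - 4)) ∧
    (G.IsG3 → 2 < n →
      hilbertSeries (G.binomialEdgeIdeal K) =
        ((1 - PowerSeries.X) ^ (n + 1))⁻¹ *
          (1 + 2 * PowerSeries.X) * (1 + PowerSeries.X) ^ (n - 3)) :=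
  ⟨fun h _ => h.hilbertSeries_binomialEdgeIdeal, fun h _ => h.hilbertSeries_binomialEdgeIdeal⟩
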